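/- Let $\mathbb K\in\{\mathbb R,\mathbb C\}$. For a normed space $X$ over $\mathbb K$ write $B_X$ and $S_X$ for its closed unit ball and unit sphere, and let $\mathbb T=\{\theta\in\mathbb K:|\theta|=1\}$. The space $X$ has the super alternative Daugavet property (super ADP) if \[ \sup_{y\in W}\max_{\theta\in\mathbb T}\|x+\theta y\|=2 \] for every $x\in S_X$ and every relatively weakly open subset $W$ of $B_X$ that intersects $S_X$. A linear subspace $X$ of a Banach space $Y$ is an almost isometric ideal of $Y$ if for every $\varepsilon>0$ and every finite-dimensional subspace $E$ of $Y$ there is a bounded linear operator $T\colon E\to X$ such that $T(e)=e$ for all $e\in E\cap X$ and $(1-\varepsilon)\|e\|\le\|T(e)\|\le(1+\varepsilon)\|e\|$ for all $e\in E$. Let $Y$ be a Banach space over $\mathbb K$ with the super ADP. Then: 1. Every linear subspace $X$ of $Y$ that is an almost isometric ideal of $Y$ has the super ADP. 2. If $Y$ is infinite-dimensional and $Z$ is a separable linear subspace of $Y$, then there is a closed separable linear subspace $W$ of $Y$ that contains $Z$ and has the super ADP. -/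

import Mathlib

/-- `W` is a relatively weakly open subset of the closed unit ball of `X`: the intersection of the
ball with a subset of `X` that is open for the weak topology `σ(X, X*)`. -/
def IsRelWeaklyOpenInBall (𝕜 : Type*) [RCLike 𝕜] {X : Type*} [NormedAddCommGroup X]
    [NormedSpace 𝕜 X] (W : Set X) : Prop :=
  ∃ V : Set (WeakSpace 𝕜 X), IsOpen V ∧ W = Metric.closedBall 0 1 ∩ toWeakSpace 𝕜 X ⁻¹' V

/-- The super alternative Daugavet property: for every `x` in the unit sphere and every relatively
weakly open subset `W` of the unit ball that meets the unit sphere,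
`sup_{y ∈ W} max_{|θ| = 1} ‖x + θ y‖ = 2`. -/
def SuperADP (𝕜 : Type*) [RCLike 𝕜] (X : Type*) [NormedAddCommGroup X] [NormedSpace 𝕜 X] : Prop :=
  ∀ x ∈ Metric.sphere (0 : X) 1, ∀ W : Set X, IsRelWeaklyOpenInBall 𝕜 W →
    (W ∩ Metric.sphere (0 : X) 1).Nonempty →
      IsLUB {r : ℝ | ∃ y ∈ W,
        IsGreatest ((fun θ : 𝕜 => ‖x + θ • y‖) '' Metric.sphere (0 : 𝕜) 1) r} 2

/-- The subspace `X` of `Y` is an almost isometric ideal of `Y`. -/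
def IsAlmostIsometricIdeal {𝕜 : Type*} [RCLike 𝕜] {Y : Type*} [NormedAddCommGroup Y]
    [NormedSpace 𝕜 Y] (X : Submodule 𝕜 Y) : Prop :=
  ∀ ε : ℝ, 0 < ε → ∀ E : Submodule 𝕜 Y, FiniteDimensional 𝕜 E →
    ∃ T : E →L[𝕜] X,
      (∀ e : E, (e : Y) ∈ X → ((T e : X) : Y) = (e : Y)) ∧
      ∀ e : E, (1 - ε) * ‖e‖ ≤ ‖T e‖ ∧ ‖T e‖ ≤ (1 + ε) * ‖e‖

/-!
Both parts rest on a reformulation: `X` has the super ADP if and only if, for all unit vectors `x`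
and `y`, the vector `y` is a weak cluster point of the vectors `z` in the unit ball for which
`max_{|θ| = 1} ‖x + θ z‖` is almost `2`. This is `WeaklyAlmostAttains`; the equivalence is
`SuperADP.weaklyAlmostAttains` and `superADP_of_weaklyAlmostAttains`, and it makes only finitely
many functionals matter at a time.

For an almost isometric ideal `X` of `Y`, the local operators `E → X` form a net along which the
functionals of `X` can be pulled back. An ultrafilter limit of the pullbacks turns each functional
`f` on `X` into a functional `g` on `Y` (`exists_strongDual_tendsto`). A witness `z` in `Y` for
finitely many such `g` is then mapped into `X` by an operator late in the net: this fixes `x` and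
`y`, almost preserves norms, and sends `f` of the image close to `g z`. After scaling back to the
unit ball, the image is a witness in `X`.

For the separable subspace, the weak topology is countably tight (Kaplansky), so for each pair
`(x, y)` countably many witnesses suffice for all tuples of functionals at once
(`WeaklyAlmostAttains.exists_countable`, from the Banach–Alaoglu theorem). Since the relation is
norm closed in `(x, y)`, a separable subspace needs countably many witnesses in all. Adding them
repeatedly, and taking the closure of the union, gives a closed separable subspace that contains
its own witnesses; by the Hahn–Banach theorem, functionals on it are restrictions of functionals
on `Y`, so it has the super ADP.
-/

open Filter Topology Metric Set

/-! ### Weak approximation by witnesses of the super ADP -/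

section Attains

variable {𝕜 : Type*} [RCLike 𝕜] {X : Type*} [NormedAddCommGroup X] [NormedSpace 𝕜 X]

/-- The point `y` is a weak cluster point of those `z` in `A`, `‖z‖ ≤ 1`, for which
`max_{|θ| = 1} ‖x + θ z‖` is almost `2`. Basic weak neighbourhoods are given by finite tuples of
functionals, and a single `ε` controls both approximations. -/
def WeaklyAlmostAttains (𝕜 : Type*) [RCLike 𝕜] {X : Type*} [NormedAddCommGroup X]
    [NormedSpace 𝕜 X] (A : Set X) (x y : X) : Prop :=
  ∀ (n : ℕ) (f : Fin n → StrongDual 𝕜 X) (ε : ℝ), 0 < ε →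
    ∃ z ∈ A, ‖z‖ ≤ 1 ∧ (∃ θ : 𝕜, ‖θ‖ = 1 ∧ 2 - ε < ‖x + θ • z‖) ∧ ∀ i, ‖f i (z - y)‖ < ε

theorem WeaklyAlmostAttains.mono {A B : Set X} {x y : X} (h : WeaklyAlmostAttains 𝕜 A x y)
    (hAB : A ⊆ B) : WeaklyAlmostAttains 𝕜 B x y := fun n f ε hε =>
  let ⟨z, hz, h⟩ := h n f ε hε
  ⟨z, hAB hz, h⟩

theorem exists_pos_lt_forall_opNorm_mul_lt {n : ℕ} (f : Fin n → StrongDual 𝕜 X) {ε : ℝ} (hε : 0 < ε) :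
    ∃ δ : ℝ, 0 < δ ∧ δ < ε ∧ ∀ i, ‖f i‖ * δ < ε := by
  set M : ℝ := ∑ i, ‖f i‖
  have hM : 0 ≤ M := Finset.sum_nonneg fun _ _ => norm_nonneg _
  have hfM : ∀ i, ‖f i‖ ≤ M := fun i =>
    Finset.single_le_sum (f := fun i => ‖f i‖) (fun _ _ => norm_nonneg _) (Finset.mem_univ i)
  refine ⟨ε / (M + 2), by positivity, div_lt_self hε (by linarith), fun i => ?_⟩
  calc ‖f i‖ * (ε / (M + 2)) ≤ M * (ε / (M + 2)) := by gcongr; exact hfM i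
    _ < (M + 2) * (ε / (M + 2)) := by gcongr; linarith
    _ = ε := by field_simp

theorem norm_apply_lt_of_norm_le {f : StrongDual 𝕜 X} {v : X} {δ ε : ℝ} (hv : ‖v‖ ≤ δ)
    (hf : ‖f‖ * δ < ε) : ‖f v‖ < ε :=
  (f.le_opNorm v).trans_lt <| (mul_le_mul_of_nonneg_left hv (norm_nonneg f)).trans_lt hf

/-- The set of pairs `(x, y)` with `WeaklyAlmostAttains 𝕜 A x y` is norm closed. -/
theorem WeaklyAlmostAttains.of_approx {A : Set X} {x y : X}
    (h : ∀ η : ℝ, 0 < η → ∃ x' y', ‖x - x'‖ < η ∧ ‖y - y'‖ < η ∧ WeaklyAlmostAttains 𝕜 A x' y') :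
    WeaklyAlmostAttains 𝕜 A x y := by
  intro n f ε hε
  obtain ⟨δ, hδ, hδε, hfδ⟩ := exists_pos_lt_forall_opNorm_mul_lt f (half_pos hε)
  obtain ⟨x', y', hx, hy, h⟩ := h δ hδ
  obtain ⟨z, hzA, hz1, ⟨θ, hθ, hxz⟩, hfz⟩ := h n f (ε / 2) (half_pos hε)
  refine ⟨z, hzA, hz1, ⟨θ, hθ, ?_⟩, fun i => ?_⟩
  · have h1 : x' + θ • z = (x + θ • z) - (x - x') := by abel
    have h2 := norm_sub_le (x + θ • z) (x - x')
    rw [← h1] at h2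
    linarith
  · have h1 : f i (z - y) = f i (z - y') - f i (y - y') := by rw [← map_sub]; congr 1; abel
    have h2 : ‖f i (y - y')‖ < ε / 2 := norm_apply_lt_of_norm_le hy.le (hfδ i)
    rw [h1]
    linarith [norm_sub_le (f i (z - y')) (f i (y - y')), hfz i]

/-- **Kaplansky's theorem** (countable tightness of the weak topology) in the present setting: a
countable set of witnesses suffices, although there may be uncountably many tuples of functionals.
By Banach–Alaoglu, finitely many witnesses serve all `n`-tuples from a ball of the dual. -/
theorem WeaklyAlmostAttains.exists_countable {x y : X}
    (h : WeaklyAlmostAttains 𝕜 (univ : Set X) x y) :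
    ∃ A : Set X, A.Countable ∧ WeaklyAlmostAttains 𝕜 A x y := by
  have key : ∀ n m : ℕ, ∃ F : Finset X, ∀ f : Fin n → StrongDual 𝕜 X, (∀ i, ‖f i‖ ≤ m) →
      ∃ z ∈ F, ‖z‖ ≤ 1 ∧ (∃ θ : 𝕜, ‖θ‖ = 1 ∧ 2 - 1 / ((m : ℝ) + 1) < ‖x + θ • z‖) ∧
        ∀ i, ‖f i (z - y)‖ < 1 / ((m : ℝ) + 1) := by
    intro n m
    have hm : (0 : ℝ) < 1 / ((m : ℝ) + 1) := Nat.one_div_pos_of_nat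
    set G : Set X := {z | ‖z‖ ≤ 1 ∧
      ∃ θ : 𝕜, ‖θ‖ = 1 ∧ 2 - 1 / ((m : ℝ) + 1) < ‖x + θ • z‖}
    have hK : IsCompact (Set.pi univ fun _ : Fin n =>
        (WeakDual.toStrongDual ⁻¹' closedBall (0 : StrongDual 𝕜 X) m : Set (WeakDual 𝕜 X))) :=
      isCompact_univ_pi fun _ => WeakDual.isCompact_closedBall 0 m
    obtain ⟨t, ht⟩ := hK.elim_finite_subcover
      (fun z : G => {g : Fin n → WeakDual 𝕜 X | ∀ i, ‖g i ((z : X) - y)‖ < 1 / ((m : ℝ) + 1)})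
      (fun z => by
        simp only [ofPred_forall]
        refine isOpen_iInter_of_finite fun i => isOpen_lt ?_ continuous_const
        exact ((WeakDual.eval_continuous _).comp (continuous_apply i)).norm)
      (fun g _ => by
        obtain ⟨z, -, hz1, hz2, hz3⟩ := h n (fun i => WeakDual.toStrongDual (g i)) _ hm
        exact mem_iUnion.2 ⟨⟨z, hz1, hz2⟩, hz3⟩)
    classical
    refine ⟨t.image (↑), fun f hf => ?_⟩
    have hmem : (fun i => StrongDual.toWeakDual (f i)) ∈ Set.pi univ fun _ : Fin n =>
        (WeakDual.toStrongDual ⁻¹' closedBall (0 : StrongDual 𝕜 X) m : Set (WeakDual 𝕜 X)) :=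
      fun i _ => by simpa using hf i
    obtain ⟨z, hzt, hz⟩ := mem_iUnion₂.1 (ht hmem)
    exact ⟨z, Finset.mem_image_of_mem _ hzt, z.2.1, z.2.2, hz⟩
  choose F hF using key
  refine ⟨⋃ n, ⋃ m, (F n m : Set X),
    countable_iUnion fun n => countable_iUnion fun m => (F n m).countable_toSet, ?_⟩
  intro n f ε hε
  obtain ⟨k, hk⟩ := exists_nat_ge (∑ i, ‖f i‖)
  obtain ⟨l, hl⟩ := exists_nat_one_div_lt hε
  have hfm : ∀ i, ‖f i‖ ≤ ((max k l : ℕ) : ℝ) := fun i =>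
    (Finset.single_le_sum (f := fun i => ‖f i‖) (fun _ _ => norm_nonneg _)
      (Finset.mem_univ i)).trans (hk.trans (by exact_mod_cast le_max_left k l))
  obtain ⟨z, hzF, hz1, ⟨θ, hθ, hz2⟩, hz3⟩ := hF n (max k l) f hfm
  have hle : 1 / (((max k l : ℕ) : ℝ) + 1) < ε :=
    (Nat.one_div_le_one_div (le_max_right k l)).trans_lt hl
  exact ⟨z, mem_iUnion₂.2 ⟨n, max k l, hzF⟩, hz1, ⟨θ, hθ, by linarith⟩, fun i => (hz3 i).trans hle⟩

theorem SuperADP.weaklyAlmostAttains (h : SuperADP 𝕜 X) {x y : X} (hx : ‖x‖ = 1) (hy : ‖y‖ = 1) :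
    WeaklyAlmostAttains 𝕜 (univ : Set X) x y := by
  intro n f ε hε
  let V : Set (WeakSpace 𝕜 X) :=
    {w | ∀ i, ‖topDualPairing 𝕜 X (f i) ((toWeakSpace 𝕜 X).symm w - y)‖ < ε}
  have hV : IsOpen V := by
    simp only [V, ofPred_forall, map_sub]
    refine isOpen_iInter_of_finite fun i => isOpen_lt (Continuous.norm ?_) continuous_const
    exact (WeakBilin.eval_continuous (topDualPairing 𝕜 X).flip (f i)).sub continuous_const
  have hlub := h x (by simpa using hx) _ ⟨V, hV, rfl⟩
    ⟨y, ⟨by simp [hy], by simp [V, hε]⟩, by simpa using hy⟩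
  obtain ⟨r, ⟨z, hz, ⟨θ, hθ, rfl⟩, -⟩, hr, -⟩ := hlub.exists_between (sub_lt_self 2 hε)
  exact ⟨z, mem_univ z, by simpa using hz.1, ⟨θ, by simpa using hθ, hr⟩, hz.2⟩

theorem superADP_of_weaklyAlmostAttains
    (h : ∀ x y : X, ‖x‖ = 1 → ‖y‖ = 1 → WeaklyAlmostAttains 𝕜 (univ : Set X) x y) :
    SuperADP 𝕜 X := by
  rintro x hx W ⟨V, hV, rfl⟩ ⟨y, ⟨hy1, hyV⟩, hy⟩
  rw [mem_sphere_zero_iff_norm] at hx hy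
  refine ⟨?_, fun b hb => le_of_forall_sub_le fun ε hε => ?_⟩
  · rintro r ⟨z, ⟨hz, -⟩, ⟨θ, hθ, rfl⟩, -⟩
    rw [mem_closedBall_zero_iff] at hz
    rw [mem_sphere_zero_iff_norm] at hθ
    calc ‖x + θ • z‖ ≤ ‖x‖ + ‖θ • z‖ := norm_add_le _ _
      _ ≤ 2 := by rw [norm_smul, hx, hθ]; linarith
  · obtain ⟨s, r, hr, hs⟩ := ((LinearMap.weakBilin_withSeminorms
      (topDualPairing 𝕜 X).flip).mem_nhds_iff (toWeakSpace 𝕜 X y) V).1 (hV.mem_nhds hyV)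
    obtain ⟨z, -, hz1, ⟨θ, hθ, hxz⟩, hfz⟩ := h x y hx hy s.card
      (fun i => (s.equivFin.symm i : StrongDual 𝕜 X)) (min r ε) (lt_min hr hε)
    have hsup : (s.sup (topDualPairing 𝕜 X).flip.toSeminormFamily) (z - y) < r := by
      refine Seminorm.finset_sup_apply_lt hr fun g hg => ?_
      simpa using (hfz (s.equivFin ⟨g, hg⟩)).trans_le (min_le_left r ε)
    have hzV : toWeakSpace 𝕜 X z ∈ V := hs hsup
    obtain ⟨θ', hθ', hmax⟩ := (isCompact_sphere (0 : 𝕜) 1).exists_isMaxOn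
      ⟨θ, by simpa using hθ⟩ (f := fun θ : 𝕜 => ‖x + θ • z‖) (by fun_prop)
    have h1 : ‖x + θ' • z‖ ≤ b := hb ⟨z, ⟨by simpa using hz1, hzV⟩, ⟨θ', hθ', rfl⟩, by
      rintro _ ⟨t, ht, rfl⟩
      exact hmax ht⟩
    have h2 : ‖x + θ • z‖ ≤ ‖x + θ' • z‖ := hmax (show θ ∈ sphere (0 : 𝕜) 1 by simpa using hθ)
    linarith [min_le_right r ε]

/-- A subspace has the super ADP as soon as it contains the witnesses needed in the ambient space;
functionals on the subspace are extended by the Hahn–Banach theorem. -/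
theorem superADP_submodule_of_weaklyAlmostAttains {W : Submodule 𝕜 X}
    (h : ∀ x ∈ W, ∀ y ∈ W, ‖x‖ = 1 → ‖y‖ = 1 → WeaklyAlmostAttains 𝕜 (W : Set X) x y) :
    SuperADP 𝕜 W := by
  refine superADP_of_weaklyAlmostAttains fun x y hx hy n f ε hε => ?_
  choose g hg _ using fun i => exists_extension_norm_eq W (f i)
  obtain ⟨z, hzW, hz1, ⟨θ, hθ, hxz⟩, hgz⟩ := h x x.2 y y.2 hx hy n g ε hε
  refine ⟨⟨z, hzW⟩, mem_univ _, hz1, ⟨θ, hθ, hxz⟩, fun i => ?_⟩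
  rw [← hg i]
  exact hgz i

end Attains

/-! ### Separable subspaces closed under witnesses -/

section Separable

variable {𝕜 : Type*} [RCLike 𝕜] {Y : Type*} [NormedAddCommGroup Y] [NormedSpace 𝕜 Y]

theorem mem_closure_unit_of_mem_closure {U : Submodule 𝕜 Y} {x : Y}
    (hx : x ∈ closure (U : Set Y)) (hx1 : ‖x‖ = 1) : x ∈ closure {u : Y | u ∈ U ∧ ‖u‖ = 1} := by
  have hx0 : ‖x‖ ≠ 0 := by simp [hx1]
  have hne : (𝓝[(U : Set Y)] x).NeBot := mem_closure_iff_nhdsWithin_neBot.1 hx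
  have hlim : Tendsto (fun u : Y => ((‖u‖⁻¹ : ℝ) : 𝕜) • u) (𝓝[(U : Set Y)] x) (𝓝 x) := by
    have h : ContinuousAt (fun u : Y => ((‖u‖⁻¹ : ℝ) : 𝕜) • u) x :=
      (RCLike.continuous_ofReal.continuousAt.comp (continuous_norm.continuousAt.inv₀ hx0)).smul
        continuousAt_id
    have h' := h.tendsto
    simp only [hx1, inv_one, RCLike.ofReal_one, one_smul] at h'
    exact h'.mono_left nhdsWithin_le_nhds
  refine mem_closure_of_tendsto hlim ?_
  have hnz : ∀ᶠ u in 𝓝[(U : Set Y)] x, ‖u‖ ≠ 0 :=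
    nhdsWithin_le_nhds (continuous_norm.continuousAt.eventually_ne hx0)
  filter_upwards [hnz, self_mem_nhdsWithin] with u hu huU
  refine ⟨U.smul_mem _ huU, ?_⟩
  rw [norm_smul, RCLike.norm_ofReal, abs_of_nonneg (by positivity), inv_mul_cancel₀ hu]

/-- Approximating a pair of vectors by a set of pairs whose witnesses lie in `A`. -/
theorem weaklyAlmostAttains_of_mem_closure {A D : Set Y} {x y : Y} (hx : x ∈ closure D)
    (hy : y ∈ closure D) (h : ∀ x ∈ D, ∀ y ∈ D, WeaklyAlmostAttains 𝕜 A x y) :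
    WeaklyAlmostAttains 𝕜 A x y := by
  refine .of_approx fun η hη => ?_
  obtain ⟨x', hx', hxx⟩ := Metric.mem_closure_iff.1 hx η hη
  obtain ⟨y', hy', hyy⟩ := Metric.mem_closure_iff.1 hy η hη
  exact ⟨x', y', by rwa [← dist_eq_norm], by rwa [← dist_eq_norm], h x' hx' y' hy'⟩

theorem SuperADP.exists_separable_witnesses (hY : SuperADP 𝕜 Y) {V : Submodule 𝕜 Y}
    (hV : TopologicalSpace.IsSeparable (V : Set Y)) :
    ∃ V' : Submodule 𝕜 Y, TopologicalSpace.IsSeparable (V' : Set Y) ∧ V ≤ V' ∧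
      ∀ x ∈ V, ∀ y ∈ V, ‖x‖ = 1 → ‖y‖ = 1 → WeaklyAlmostAttains 𝕜 (V' : Set Y) x y := by
  have hS : TopologicalSpace.IsSeparable {u : Y | u ∈ V ∧ ‖u‖ = 1} := hV.mono fun u hu => hu.1
  obtain ⟨D, hDS, hD, hSD⟩ := hS.exists_countable_dense_subset
  have hA : ∀ x y : Y, ∃ A : Set Y, A.Countable ∧
      (x ∈ D → y ∈ D → WeaklyAlmostAttains 𝕜 A x y) := by
    intro x y
    by_cases h : x ∈ D ∧ y ∈ D
    · obtain ⟨A, hA, h'⟩ := (hY.weaklyAlmostAttains (hDS h.1).2 (hDS h.2).2).exists_countable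
      exact ⟨A, hA, fun _ _ => h'⟩
    · exact ⟨∅, countable_empty, fun hx hy => absurd ⟨hx, hy⟩ h⟩
  choose A hAc hA using hA
  set B : Set Y := ⋃ x ∈ D, ⋃ y ∈ D, A x y
  have hB : B.Countable := hD.biUnion fun x _ => hD.biUnion fun y _ => hAc x y
  refine ⟨Submodule.span 𝕜 ((V : Set Y) ∪ B), (hV.union hB.isSeparable).span,
    fun v hv => Submodule.subset_span (Or.inl hv), fun x hx y hy hx1 hy1 => ?_⟩
  refine weaklyAlmostAttains_of_mem_closure (hSD ⟨hx, hx1⟩) (hSD ⟨hy, hy1⟩) fun x' hx' y' hy' =>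
    (hA x' y' hx' hy').mono fun a ha => Submodule.subset_span (Or.inr ?_)
  exact mem_iUnion₂.2 ⟨x', hx', mem_iUnion₂.2 ⟨y', hy', ha⟩⟩

/-- The super ADP is separably determined: close a separable subspace under countable sets of
witnesses by iterating `SuperADP.exists_separable_witnesses`, then take the norm closure. -/
theorem SuperADP.exists_separable_closed_submodule (hY : SuperADP 𝕜 Y) {Z : Submodule 𝕜 Y}
    (hZ : TopologicalSpace.IsSeparable (Z : Set Y)) :
    ∃ W : Submodule 𝕜 Y, Z ≤ W ∧ IsClosed (W : Set Y) ∧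
      TopologicalSpace.IsSeparable (W : Set Y) ∧ SuperADP 𝕜 W := by
  choose! next hsep hle hnext using
    fun (V : Submodule 𝕜 Y) (hV : TopologicalSpace.IsSeparable (V : Set Y)) =>
      hY.exists_separable_witnesses hV
  set V : ℕ → Submodule 𝕜 Y := fun k => next^[k] Z
  have hVs : ∀ k, V (k + 1) = next (V k) := fun k => Function.iterate_succ_apply' next k Z
  have hVsep : ∀ k, TopologicalSpace.IsSeparable (V k : Set Y) := by
    intro k
    induction k with
    | zero => exact hZ
    | succ k ih => rw [hVs]; exact hsep _ ih
  have hmono : Monotone V := monotone_nat_of_le_succ fun k => by rw [hVs]; exact hle _ (hVsep k)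
  have hU : ((⨆ k, V k : Submodule 𝕜 Y) : Set Y) = ⋃ k, (V k : Set Y) :=
    Submodule.coe_iSup_of_directed V hmono.directed_le
  refine ⟨(⨆ k, V k).topologicalClosure,
    (le_iSup V 0).trans (Submodule.le_topologicalClosure _),
    Submodule.isClosed_topologicalClosure _, ?_, ?_⟩
  · rw [Submodule.topologicalClosure_coe, hU]
    exact (TopologicalSpace.IsSeparable.iUnion hVsep).closure
  refine superADP_submodule_of_weaklyAlmostAttains fun x hx y hy hx1 hy1 => ?_
  refine weaklyAlmostAttains_of_mem_closure (mem_closure_unit_of_mem_closure hx hx1)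
    (mem_closure_unit_of_mem_closure hy hy1) ?_
  rintro x' ⟨hx', hx1'⟩ y' ⟨hy', hy1'⟩
  rw [← SetLike.mem_coe, hU, mem_iUnion] at hx' hy'
  obtain ⟨j, hj⟩ := hx'
  obtain ⟨l, hl⟩ := hy'
  refine (hnext (V (max j l)) (hVsep _) x' (hmono (le_max_left j l) hj) y'
    (hmono (le_max_right j l) hl) hx1' hy1').mono ?_
  rw [← hVs]
  exact (le_iSup V _).trans (Submodule.le_topologicalClosure _)

end Separable

/-! ### Almost isometric ideals -/

section Ideal

variable {𝕜 : Type*} [RCLike 𝕜] {Y : Type*} [NormedAddCommGroup Y] [NormedSpace 𝕜 Y]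

/-- The local operators of an almost isometric ideal form a net of linear maps `Y → X`, each of
which fixes `X` and distorts the norm by a vanishing amount at every given vector. The operators,
defined on finite-dimensional subspaces, are extended to `Y` without any continuity. -/
theorem IsAlmostIsometricIdeal.exists_net {X : Submodule 𝕜 Y} (hX : IsAlmostIsometricIdeal X) :
    ∃ t : Finset Y × ℕ → Y →ₗ[𝕜] X, ∀ v : Y, ∀ δ : ℝ, 0 < δ → ∀ᶠ s in atTop,
      (∀ hv : v ∈ X, t s v = ⟨v, hv⟩) ∧
      (1 - δ) * ‖v‖ ≤ ‖t s v‖ ∧ ‖t s v‖ ≤ (1 + δ) * ‖v‖ := by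
  have hT : ∀ s : Finset Y × ℕ, ∃ t : Y →ₗ[𝕜] X, ∀ v ∈ s.1,
      (∀ hv : v ∈ X, t v = ⟨v, hv⟩) ∧ (1 - 1 / ((s.2 : ℝ) + 1)) * ‖v‖ ≤ ‖t v‖ ∧
        ‖t v‖ ≤ (1 + 1 / ((s.2 : ℝ) + 1)) * ‖v‖ := by
    intro s
    obtain ⟨T, hTX, hTn⟩ := hX (1 / ((s.2 : ℝ) + 1)) Nat.one_div_pos_of_nat
      (Submodule.span 𝕜 (s.1 : Set Y)) (FiniteDimensional.span_finset 𝕜 s.1)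
    obtain ⟨t, ht⟩ := T.toLinearMap.exists_extend
    refine ⟨t, fun v hv => ?_⟩
    have htv : t v = T ⟨v, Submodule.subset_span hv⟩ :=
      LinearMap.congr_fun ht ⟨v, Submodule.subset_span hv⟩
    rw [htv]
    exact ⟨fun hvX => Subtype.ext (hTX _ hvX), hTn ⟨v, Submodule.subset_span hv⟩⟩
  choose t ht using hT
  refine ⟨t, fun v δ hδ => ?_⟩
  obtain ⟨k, hk⟩ := exists_nat_one_div_lt hδ
  filter_upwards [eventually_ge_atTop (({v} : Finset Y), k)] with s hs
  obtain ⟨h1, h2, h3⟩ := ht s v (hs.1 (Finset.mem_singleton_self v))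
  have hle : 1 / ((s.2 : ℝ) + 1) ≤ δ := (Nat.one_div_le_one_div hs.2).trans hk.le
  refine ⟨h1, le_trans ?_ h2, h3.trans ?_⟩ <;> gcongr

/-- Pulling a functional on `X` back along the net and passing to the limit along an ultrafilter
gives a functional on all of `Y`. -/
theorem exists_strongDual_tendsto {X : Type*} [NormedAddCommGroup X] [NormedSpace 𝕜 X]
    {ι : Type*} (l : Ultrafilter ι) (t : ι → Y →ₗ[𝕜] X) (C : ℝ)
    (ht : ∀ v, ∀ᶠ s in (l : Filter ι), ‖t s v‖ ≤ C * ‖v‖) (f : StrongDual 𝕜 X) :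
    ∃ g : StrongDual 𝕜 Y, ∀ v, Tendsto (fun s => f (t s v)) l (𝓝 (g v)) := by
  have hb : ∀ v, ∀ᶠ s in (l : Filter ι), f (t s v) ∈ closedBall (0 : 𝕜) (‖f‖ * C * ‖v‖) := by
    intro v
    filter_upwards [ht v] with s hs
    rw [mem_closedBall_zero_iff, mul_assoc]
    exact (f.le_opNorm _).trans (mul_le_mul_of_nonneg_left hs (norm_nonneg f))
  have hlim : ∀ v, ∃ a ∈ closedBall (0 : 𝕜) (‖f‖ * C * ‖v‖),
      Tendsto (fun s => f (t s v)) l (𝓝 a) := fun v =>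
    (isCompact_closedBall (0 : 𝕜) (‖f‖ * C * ‖v‖)).ultrafilter_le_nhds
      (l.map fun s => f (t s v)) (le_principal_iff.2 (hb v))
  choose φ hφ hlim using hlim
  let L : Y →ₗ[𝕜] 𝕜 := linearMapOfTendsto φ (fun s => f.toLinearMap ∘ₗ t s)
    (tendsto_pi_nhds.2 hlim)
  exact ⟨L.mkContinuous (‖f‖ * C) fun v => by simpa using! hφ v, hlim⟩

theorem SuperADP.of_isAlmostIsometricIdeal (hY : SuperADP 𝕜 Y) {X : Submodule 𝕜 Y}
    (hX : IsAlmostIsometricIdeal X) : SuperADP 𝕜 X := by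
  obtain ⟨t, ht⟩ := hX.exists_net
  classical
  let l : Ultrafilter (Finset Y × ℕ) := Ultrafilter.of atTop
  have hl : (l : Filter (Finset Y × ℕ)) ≤ atTop := Ultrafilter.of_le _
  refine superADP_of_weaklyAlmostAttains fun x y hx hy n f ε hε => ?_
  choose g hg using fun i => exists_strongDual_tendsto l t (1 + 1)
    (fun v => hl ((ht v 1 one_pos).mono fun s hs => hs.2.2)) (f i)
  obtain ⟨δ, hδ, hδε, hfδ⟩ := exists_pos_lt_forall_opNorm_mul_lt f (ε := ε / 4) (by positivity)
  obtain ⟨z, -, hz1, ⟨θ, hθ, hxz⟩, hgz⟩ :=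
    hY.weaklyAlmostAttains (x := (x : Y)) (y := (y : Y)) hx hy n g (ε / 4) (by positivity)
  have hev : ∀ᶠ s in (l : Filter (Finset Y × ℕ)), ∀ i, ‖f i (t s (z - y))‖ < ε / 4 :=
    eventually_all.2 fun i => (hg i (z - y)).norm.eventually (gt_mem_nhds (hgz i))
  obtain ⟨s, hfs, ⟨hsx, -⟩, ⟨hsy, -⟩, ⟨-, -, hsz⟩, ⟨-, hsxz, -⟩⟩ :=
    (hev.and (hl ((ht x δ hδ).and ((ht y δ hδ).and ((ht z δ hδ).and
      (ht (x + θ • z) δ hδ)))))).exists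
  have htx : t s x = x := hsx x.2
  have hty : t s y = y := hsy y.2
  have htz : ‖t s z‖ ≤ 1 + δ := hsz.trans (by nlinarith)
  rw [map_add, map_smul, htx] at hsxz
  -- `t s z` may stick out of the unit ball by `δ`, so it is scaled back
  set c : 𝕜 := ((1 / (1 + δ) : ℝ) : 𝕜)
  set w : X := c • t s z
  have hc : ‖c‖ = 1 / (1 + δ) := by
    rw [RCLike.norm_ofReal, abs_of_pos (by positivity)]
  have hw1 : ‖w‖ ≤ 1 := by
    rw [norm_smul, hc, one_div_mul_eq_div, div_le_one (by positivity)]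
    exact htz
  have hwz : ‖w - t s z‖ ≤ δ := by
    have h1 : w - t s z = -((δ : 𝕜) • w) := by
      have h2 : (1 + (δ : 𝕜)) * c = 1 := by
        have : (1 + δ) * (1 / (1 + δ)) = 1 := by field_simp
        simp only [c]
        exact_mod_cast this
      have h3 : t s z = (1 + (δ : 𝕜)) • w := by rw [smul_smul, h2, one_smul]
      rw [h3, add_smul, one_smul]
      abel
    rw [h1, norm_neg, norm_smul, RCLike.norm_ofReal, abs_of_pos hδ]
    exact mul_le_of_le_one_right hδ.le hw1
  refine ⟨w, mem_univ w, hw1, ⟨θ, hθ, ?_⟩, fun i => ?_⟩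
  · have h1 : x + θ • t s z = (x + θ • w) - θ • (w - t s z) := by rw [smul_sub]; abel
    have h2 := norm_sub_le (x + θ • w) (θ • (w - t s z))
    rw [← h1, norm_smul, hθ, one_mul] at h2
    have h3 : ‖(x : Y) + θ • z‖ ≤ 2 := by
      refine (norm_add_le _ _).trans ?_
      rw [norm_smul, hθ, one_mul]
      have : ‖(x : Y)‖ = 1 := hx
      linarith
    nlinarith
  · have h1 : f i (w - y) = f i (w - t s z) + f i (t s (z - y)) := by
      rw [← map_add, map_sub (t s), hty]
      congr 1
      abel
    rw [h1]
    have h2 := norm_apply_lt_of_norm_le hwz (hfδ i)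
    linarith [norm_add_le (f i (w - t s z)) (f i (t s (z - y))), hfs i]

end Ideal

theorem mainTheorem5 {𝕜 : Type*} [RCLike 𝕜] {Y : Type*} [NormedAddCommGroup Y] [NormedSpace 𝕜 Y]
    [CompleteSpace Y] (hY : SuperADP 𝕜 Y) :
    (∀ X : Submodule 𝕜 Y, IsAlmostIsometricIdeal X → SuperADP 𝕜 X) ∧
    (¬ FiniteDimensional 𝕜 Y →
      ∀ Z : Submodule 𝕜 Y, TopologicalSpace.IsSeparable (Z : Set Y) →
        ∃ W : Submodule 𝕜 Y, Z ≤ W ∧ IsClosed (W : Set Y) ∧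
          TopologicalSpace.IsSeparable (W : Set Y) ∧ SuperADP 𝕜 W) := by
  exact ⟨fun X hX => hY.of_isAlmostIsometricIdeal hX,
    fun _ Z hZ => hY.exists_separable_closed_submodule hZ⟩
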